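/- **Constant scales.** Let $0<\alpha<1$, $0\le a<1$, and let $\tau(1),\tau(2),\dots$ be i.i.d. positive random variables on a probability space $(\Omega,\mathcal F,\mathbb P)$, distributed as $\tau$, with $\mathbb P(\tau>u)=u^{-\alpha}L(u)$ for $u>0$, where $L$ is slowly varying at infinity. For $n\ge1$ and a realization of the landscape, put $\pi_n(x)=\tau(x)^a/\sum_{y=1}^n\tau(y)^a$ and $\lambda_n(x)=\tau(x)^{-(1-a)}$ for $x\in\{1,\dots,n\}$. Let $J_n=(J_n(i))_{i\ge0}$ be the Markov chain on $\{1,\dots,n\}$ with transition probabilities $p_n(x,y)=\pi_n(y)$ and initial distribution $\mu_n=\pi_n$, and let $(e_{n,i})_{i\ge 0}$ be independent exponential random variables of mean one, independent of $J_n$. Fix a constant $r>0$ (constant space scale $r_n=r$), set $c_n=r^{1-a}$ and $a_n=1$, and let $$S_n(t)=c_n^{-1}\sum_{i=1}^{\lfloor a_nt\rfloor}\lambda_n(J_n(i))^{-1}e_{n,i},\qquad t\ge0 .$$ For a probability law $\nu$ on $(0,\infty]$, the renewal process of inter-arrival distribution $\nu$ is $R(k)=\xi_1+\dots+\xi_k$,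 $k\ge 0$, with $\xi_1,\xi_2,\dots$ independent of law $\nu$. (i) If $a<\alpha$, then $\mathbb E\tau^a<\infty$, there is a probability measure $\nu$ on $(0,\infty)$ with $$\nu(u,\infty)=\frac{\mathbb E\bigl[\tau^a e^{-u(r/\tau)^{1-a}}\bigr]}{\mathbb E\tau^a},\quad u>0$$ (for $r=1$ this is $\mathbb E[\tau^ae^{-u/\tau^{1-a}}]/\mathbb E\tau^a$), and, $\mathbb P$-almost surely, the law of $(S_n(k))_{k\ge0}$ given the landscape converges weakly in $\mathbb R^\infty$, as $n\to\infty$, to the law of the renewal process $(R(k))_{k\ge0}$ of inter-arrival distribution $\nu$. (ii) If $a>\alpha$, then, in $\mathbb P$-probability, the law of $(S_n(k))_{k\ge0}$ given the landscape converges weakly, as a law on $[0,\infty]^{\infty}$, to the law of the degenerate renewal process of inter-arrival distribution $\delta_\infty$ (that is, $R(0)=0$ and $R(k)=\infty$ for $k\ge1$). -/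

import Mathlib

open MeasureTheory ProbabilityTheory Filter Topology
open scoped ENNReal

namespace TrapModel

/-! ### The landscape -/

/-- `L` is slowly varying at infinity: it is eventually positive and
`L (c x) / L x → 1` as `x → ∞`, for every `c > 0`. -/
def SlowlyVarying (L : ℝ → ℝ) : Prop :=
  (∀ᶠ x in atTop, 0 < L x) ∧ ∀ c : ℝ, 0 < c → Tendsto (fun x => L (c * x) / L x) atTop (𝓝 1)

/-- The class `𝒟(α)` of laws `ρ` on the line with `ρ (u, ∞) = u ^ (-α) L(u)`, where `L` is slowly
varying at infinity. -/
def InDomain (α : ℝ) (ρ : Measure ℝ) : Prop :=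
  ∃ L : ℝ → ℝ, SlowlyVarying L ∧ ∀ u : ℝ, 0 < u → ρ.real (Set.Ioi u) = u ^ (-α) * L u

/-! ### The asymmetric trap model on the complete graph with vertex set `V`, with loops

`τ : V → ℝ` is a fixed realization of the landscape, `a` the asymmetry parameter. -/

section Model

variable {V : Type*} [Fintype V]

/-- The holding time parameters `λ(x) = τ(x) ^ (-(1 - a))`. -/
noncomputable def holdRate (a : ℝ) (τ : V → ℝ) (x : V) : ℝ := τ x ^ (-(1 - a))

/-- The measure `π(x) = τ(x) ^ a / ∑ y, τ(y) ^ a`. -/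
noncomputable def invMeas (a : ℝ) (τ : V → ℝ) (x : V) : ℝ := τ x ^ a / ∑ y, τ y ^ a

/-- The transition probabilities of the jump chain,
`p(x, y) = τ(y) ^ a / ∑ z, τ(z) ^ a`, for all vertices `x`, `y`, including `x = y`. -/
noncomputable def jumpProb (a : ℝ) (τ : V → ℝ) (_x y : V) : ℝ := τ y ^ a / ∑ z, τ z ^ a

/-- A realization, for the landscape `τ`, of the dynamics with initial distribution `μ`: on a
probability space `(Y, prob)`, a Markov chain `J` with initial distribution `μ` and transition
probabilities `jumpProb a τ`, and a family `e` of independent exponential random variables of mean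
one, independent of `J`. -/
structure Dynamics [MeasurableSpace V] (a : ℝ) (τ : V → ℝ) (μ : V → ℝ)
    (Y : Type*) [MeasurableSpace Y] where
  /-- the underlying probability measure -/
  prob : ProbabilityMeasure Y
  /-- the jump chain -/
  J : ℕ → Y → V
  /-- the normalized holding times -/
  e : ℕ → Y → ℝ
  measurable_J : ∀ i, Measurable (J i)
  measurable_e : ∀ i, Measurable (e i)
  /-- the finite dimensional distributions of the Markov chain -/
  chain : ∀ (k : ℕ) (x : ℕ → V),
    (prob : Measure Y).real {y | ∀ i ≤ k, J i y = x i} =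
      μ (x 0) * ∏ i ∈ Finset.range k, jumpProb a τ (x i) (x (i + 1))
  law_e : ∀ i, (prob : Measure Y).map (e i) = expMeasure 1
  indep_e : iIndepFun e (prob : Measure Y)
  indep_J_e : IndepFun (fun y i => J i y) (fun y i => e i y) (prob : Measure Y)

variable [MeasurableSpace V] [DiscreteMeasurableSpace V] {a : ℝ} {τ μ : V → ℝ}
  {Y : Type*} [MeasurableSpace Y]

/-- `c⁻¹ ∑ i = 1, …, k, λ(J(i))⁻¹ e(i)`, where `c` is the time scale. -/
noncomputable def Dynamics.partialSum (D : Dynamics a τ μ Y) (c : ℝ) (k : ℕ) (y : Y) : ℝ :=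
  c⁻¹ * ∑ i ∈ Finset.Icc 1 k, (holdRate a τ (D.J i y))⁻¹ * D.e i y

/-- The pure clock process `S(t)`, `t ≥ 0`, with time scale `c` and auxiliary time scale `b`. -/
noncomputable def Dynamics.clock (D : Dynamics a τ μ Y) (b c t : ℝ) (y : Y) : ℝ :=
  D.partialSum c ⌊b * t⌋₊ y

theorem Dynamics.measurable_clock (D : Dynamics a τ μ Y) (b c t : ℝ) :
    Measurable (D.clock b c t) := by
  unfold Dynamics.clock Dynamics.partialSum
  refine Measurable.const_mul (Finset.measurable_fun_sum _ fun i _ => ?_) _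
  exact ((measurable_of_countable (holdRate a τ)).comp (D.measurable_J i)).inv.mul
    (D.measurable_e i)

/-- The law on `ℝ^∞` of the sequence `S(k)`, `k = 0, 1, 2, …`, for the auxiliary time scale `1` and
the time scale `c`. -/
noncomputable def Dynamics.clockLaw (D : Dynamics a τ μ Y) (c : ℝ) :
    ProbabilityMeasure (ℕ → ℝ) :=
  D.prob.map (f := fun y (k : ℕ) => D.clock 1 c k y)
    (measurable_pi_lambda _ fun k : ℕ => D.measurable_clock 1 c k).aemeasurable

/-- The law of the sequence `S(k)`, `k = 0, 1, 2, …`, as a sequence of elements of `[0, ∞]`. -/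
noncomputable def Dynamics.clockLawExt (D : Dynamics a τ μ Y) (c : ℝ) :
    ProbabilityMeasure (ℕ → ℝ≥0∞) :=
  D.prob.map (f := fun y (k : ℕ) => ENNReal.ofReal (D.clock 1 c k y))
    (measurable_pi_lambda _ fun k : ℕ => (D.measurable_clock 1 c k).ennreal_ofReal).aemeasurable

end Model

/-! ### Renewal processes and modes of convergence -/

/-- The law of the renewal process `R(k) = ξ 1 + ⋯ + ξ k`, `k = 0, 1, 2, …`, where the `ξ i` are
independent with law `ν`. With `M = ℝ≥0∞` the inter-arrival times may be infinite. -/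
noncomputable def renewalLaw {M : Type*} [MeasurableSpace M] [AddCommMonoid M] [MeasurableAdd₂ M]
    (ν : ProbabilityMeasure M) : ProbabilityMeasure (ℕ → M) :=
  ProbabilityMeasure.map (⟨Measure.infinitePi fun _ : ℕ => (ν : Measure M), inferInstance⟩ :
      ProbabilityMeasure (ℕ → M))
    (f := fun ξ (k : ℕ) => ∑ i ∈ Finset.Icc 1 k, ξ i)
    (measurable_pi_lambda _ fun _ =>
      Finset.measurable_fun_sum _ fun i _ => measurable_pi_apply i).aemeasurable

/-- Convergence in probability, in a topological space, to a deterministic limit. -/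
def TendstoInProb {Ω E : Type*} [MeasurableSpace Ω] [TopologicalSpace E] (P : Measure Ω)
    (X : ℕ → Ω → E) (x : E) : Prop :=
  ∀ U ∈ 𝓝 x, Tendsto (fun n => P {ω | X n ω ∉ U}) atTop (𝓝 0)

end TrapModel

namespace TrapModel

/-! The jump probabilities do not depend on the starting vertex and the chain starts from `invMeas`,
so the chain is an i.i.d. sequence. For every fixed `n` and landscape the clock process at integer
times is therefore exactly a renewal process (`Dynamics.clockLaw_eq_renewalLaw`,
`Dynamics.clockLawExt_eq_renewalLaw`). Since the law of a renewal process is a continuous function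
of its inter-arrival law (`continuous_renewalLaw`), only the law of one increment has to converge.

The increment law gives a set `B` the mass `∑ τ^a h(τ) / ∑ τ^a`, with `h = holdProb a c B`
(`Dynamics.incrementLaw_real`). If `a < α`, then `τ^a` is integrable, and the strong law applied to
numerator and denominator gives almost sure convergence to a size-biased mixture of exponentials
(`ae_tendsto_sum_invMeas`, `exists_sizeBiased_holdLaw`). If `α < a`, the averages of `τ^a` diverge
(`ae_tendsto_sum_rpow_atTop`), so the weights concentrate on arbitrarily deep traps, where the
holding time exceeds any fixed bound with probability close to one; the increments escape to `∞`. -/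

/-- The law of a sequence of independent random variables of law `ν`. -/
noncomputable def iidLaw {M : Type*} [MeasurableSpace M] (ν : ProbabilityMeasure M) :
    ProbabilityMeasure (ℕ → M) :=
  ⟨Measure.infinitePi fun _ : ℕ => (ν : Measure M), inferInstance⟩

theorem toMeasure_iidLaw {M : Type*} [MeasurableSpace M] (ν : ProbabilityMeasure M) :
    (iidLaw ν : Measure (ℕ → M)) = Measure.infinitePi fun _ : ℕ => (ν : Measure M) := rfl

/-! ### Continuity of the law of a renewal process in the inter-arrival distribution -/

section Continuity

variable {M : Type*} [MeasurableSpace M] [TopologicalSpace M] [SecondCountableTopology M]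
  [TopologicalSpace.PseudoMetrizableSpace M] [BorelSpace M]

/-- The law of an i.i.d. sequence depends continuously on the law of its terms. -/
theorem continuous_iidLaw :
    Continuous (iidLaw : ProbabilityMeasure M → ProbabilityMeasure (ℕ → M)) := by
  refine continuous_iff_continuousAt.2 fun ν => ?_
  -- Cylinders over continuity sets of `ν`: a π-system containing arbitrarily small neighborhoods of
  -- each point, on which product measures are finite products. Convergence on it implies weak
  -- convergence.
  let S : Set (Set (ℕ → M)) := {t | ∃ (I : Finset ℕ) (s : ℕ → Set M), t = (I : Set ℕ).pi s ∧
    ∀ i, MeasurableSet (s i) ∧ (ν : Measure M) (frontier (s i)) = 0}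
  have hS : IsPiSystem S := by
    classical
    rintro - ⟨I, s, rfl, hs⟩ - ⟨I', s', rfl, hs'⟩ -
    refine ⟨I ∪ I', fun i => (if i ∈ I then s i else Set.univ) ∩
      (if i ∈ I' then s' i else Set.univ), ?_, fun i => ⟨?_, ?_⟩⟩
    · ext x
      simp only [Set.mem_inter_iff, Set.mem_pi, Finset.mem_coe, Finset.mem_union]
      constructor
      · rintro ⟨h, h'⟩ i -
        constructor
        · split_ifs with hi
          exacts [h i hi, trivial]
        · split_ifs with hi
          exacts [h' i hi, trivial]
      · intro h
        refine ⟨fun i hi => ?_, fun i hi => ?_⟩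
        · simpa [hi] using (h i (Or.inl hi)).1
        · simpa [hi] using (h i (Or.inr hi)).2
    · refine MeasurableSet.inter ?_ ?_ <;> split_ifs
      exacts [(hs i).1, .univ, (hs' i).1, .univ]
    · refine null_frontier_inter ?_ ?_ <;> split_ifs
      exacts [(hs i).2, by simp, (hs' i).2, by simp]
  refine hS.tendsto_probabilityMeasure_of_tendsto_of_mem ?_ ?_ ?_
  · rintro - ⟨I, s, rfl, hs⟩
    exact MeasurableSet.pi I.countable_toSet fun i _ => (hs i).1
  · let _ : PseudoMetricSpace M := TopologicalSpace.pseudoMetrizableSpacePseudoMetric M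
    intro u hu x hx
    obtain ⟨I, v, hv, hvu⟩ := isOpen_pi_iff.1 hu x hx
    have A : ∀ i, ∃ t : Set M, MeasurableSet t ∧ (ν : Measure M) (frontier t) = 0 ∧
        (i ∈ I → t ∈ 𝓝 (x i) ∧ t ⊆ v i) := by
      intro i
      by_cases hi : i ∈ I
      · obtain ⟨ε, εpos, hε⟩ := Metric.isOpen_iff.1 (hv i hi).1 (x i) (hv i hi).2
        -- Balls of different radii have disjoint frontiers, so some radius below `ε` gives a null
        -- one.
        obtain ⟨r, hr, hr0⟩ := exists_null_frontier_thickening (ν : Measure M) {x i} εpos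
        rw [Metric.thickening_singleton] at hr0
        exact ⟨_, measurableSet_ball, hr0, fun _ =>
          ⟨Metric.ball_mem_nhds _ hr.1, (Metric.ball_subset_ball hr.2.le).trans hε⟩⟩
      · exact ⟨Set.univ, .univ, by simp, fun h => absurd h hi⟩
    choose t ht ht0 htI using A
    refine ⟨(I : Set ℕ).pi t, ⟨I, t, rfl, fun i => ⟨ht i, ht0 i⟩⟩, ?_, ?_⟩
    · exact set_pi_mem_nhds I.finite_toSet fun i hi => (htI i hi).1
    · exact (Set.pi_mono fun i hi => (htI i hi).2).trans hvu
  · rintro - ⟨I, s, rfl, hs⟩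
    have key : ∀ κ : ProbabilityMeasure M,
        iidLaw κ ((I : Set ℕ).pi s) = ∏ i ∈ I, κ (s i) := by
      intro κ
      rw [← ENNReal.coe_inj, ProbabilityMeasure.ennreal_coeFn_eq_coeFn_toMeasure,
        toMeasure_iidLaw, Measure.infinitePi_pi _ fun i _ => (hs i).1]
      simp
    simp only [key]
    refine tendsto_finsetProd _ fun i _ => ?_
    refine ProbabilityMeasure.tendsto_measure_of_null_frontier_of_tendsto tendsto_id ?_
    rw [ProbabilityMeasure.null_iff_toMeasure_null]
    exact (hs i).2

theorem continuous_renewalLaw [AddCommMonoid M] [ContinuousAdd M] [MeasurableAdd₂ M] :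
    Continuous (renewalLaw : ProbabilityMeasure M → ProbabilityMeasure (ℕ → M)) := by
  have hf : Continuous fun (ξ : ℕ → M) (k : ℕ) => ∑ i ∈ Finset.Icc 1 k, ξ i :=
    continuous_pi fun k => continuous_finsetSum _ fun i _ => continuous_apply i
  exact (ProbabilityMeasure.continuous_map hf).comp continuous_iidLaw

end Continuity

/-! ### Independence -/

section Independence

variable {Ω α β : Type*} [MeasurableSpace Ω] [MeasurableSpace α] [MeasurableSpace β]
  {P : Measure Ω}

/-- Measurable rectangles form a generating π-system. On them the probability factors first between
the two families, then within each. -/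
theorem iIndepFun_prodMk {ι : Type*} {X : ι → Ω → α} {Z : ι → Ω → β}
    (mX : ∀ i, Measurable (X i)) (mZ : ∀ i, Measurable (Z i))
    (hX : iIndepFun X P) (hZ : iIndepFun Z P)
    (h : IndepFun (fun ω i => X i ω) (fun ω i => Z i ω) P) :
    iIndepFun (fun i ω => (X i ω, Z i ω)) P := by
  classical
  have := hX.isProbabilityMeasure
  let π : ι → Set (Set Ω) := fun i =>
    (fun s => (fun ω => (X i ω, Z i ω)) ⁻¹' s) ''
      Set.image2 (· ×ˢ ·) {A : Set α | MeasurableSet A} {B : Set β | MeasurableSet B}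
  refine iIndepSets.iIndep (fun i => ((mX i).prodMk (mZ i)).comap_le) π (fun i => ?_)
    (fun i => ?_) ?_
  · exact isPiSystem_prod.comap _
  · simp only [π]
    rw [← MeasurableSpace.comap_generateFrom, generateFrom_prod]
  · rw [iIndepSets_iff]
    intro I f hf
    have A : ∀ i, ∃ (A : Set α) (B : Set β), MeasurableSet A ∧ MeasurableSet B ∧
        (i ∈ I → f i = X i ⁻¹' A ∩ Z i ⁻¹' B) := by
      intro i
      by_cases hi : i ∈ I
      · obtain ⟨-, ⟨A, hA, B, hB, rfl⟩, hfi⟩ := hf i hi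
        exact ⟨A, B, hA, hB, fun _ => hfi.symm⟩
      · exact ⟨∅, ∅, .empty, .empty, fun h => absurd h hi⟩
    choose A B hA hB hf' using A
    -- Needed for `J = I` and for singletons; comparing the two gives the product formula.
    have pair : ∀ J : Finset ι, J ⊆ I → P (⋂ i ∈ J, f i) =
        (∏ i ∈ J, P (X i ⁻¹' A i)) * ∏ i ∈ J, P (Z i ⁻¹' B i) := by
      intro J hJ
      have e : (⋂ i ∈ J, f i) = (fun ω i => X i ω) ⁻¹' ((J : Set ι).pi A) ∩
          (fun ω i => Z i ω) ⁻¹' ((J : Set ι).pi B) := by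
        ext ω
        simp only [Set.mem_iInter, Set.mem_inter_iff, Set.mem_preimage, Set.mem_pi,
          Finset.mem_coe, ← forall_and]
        refine forall_congr' fun i => forall_congr' fun hi => ?_
        rw [hf' i (hJ hi)]
        rfl
      have eX : (fun ω i => X i ω) ⁻¹' ((J : Set ι).pi A) = ⋂ i ∈ J, X i ⁻¹' A i := by
        ext; simp
      have eZ : (fun ω i => Z i ω) ⁻¹' ((J : Set ι).pi B) = ⋂ i ∈ J, Z i ⁻¹' B i := by
        ext; simp
      rw [e, h.measure_inter_preimage_eq_mul _ _
        (MeasurableSet.pi J.countable_toSet fun i _ => hA i)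
        (MeasurableSet.pi J.countable_toSet fun i _ => hB i), eX, eZ,
        hX.measure_inter_preimage_eq_mul J fun i _ => hA i,
        hZ.measure_inter_preimage_eq_mul J fun i _ => hB i]
    rw [pair I subset_rfl, ← Finset.prod_mul_distrib]
    refine Finset.prod_congr rfl fun i hi => ?_
    simpa using (pair {i} (by simpa using hi)).symm

/-- Partial sums of i.i.d. random variables form a renewal process. -/
theorem map_partialSums_eq_renewalLaw {M : Type*} [MeasurableSpace M] [AddCommMonoid M]
    [MeasurableAdd₂ M] {X : ℕ → Ω → M} (mX : ∀ i, Measurable (X i)) (hX : iIndepFun X P)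
    (ν : ProbabilityMeasure M) (hν : ∀ i, P.map (X i) = ν) :
    P.map (fun ω (k : ℕ) => ∑ i ∈ Finset.Icc 1 k, X i ω) = renewalLaw ν := by
  have h1 : Measurable fun (ξ : ℕ → M) (k : ℕ) => ∑ i ∈ Finset.Icc 1 k, ξ i :=
    measurable_pi_lambda _ fun _ =>
      Finset.measurable_fun_sum _ fun i _ => measurable_pi_apply i
  have h2 := hX.map_fun_eq_infinitePi_map mX
  simp only [hν] at h2
  have h3 : (renewalLaw ν : Measure (ℕ → M)) =
      (Measure.infinitePi fun _ : ℕ => (ν : Measure M)).map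
        (fun ξ (k : ℕ) => ∑ i ∈ Finset.Icc 1 k, ξ i) := rfl
  rw [h3, ← h2, Measure.map_map h1 (measurable_pi_lambda _ mX)]
  rfl

/-- A sequence of random variables in a finite set whose finite dimensional distributions are of
product form is i.i.d. -/
theorem iIndepFun_of_measureReal_eq_prod {V : Type*} [Fintype V] [MeasurableSpace V]
    [DiscreteMeasurableSpace V] [IsProbabilityMeasure P] {J : ℕ → Ω → V}
    (mJ : ∀ i, Measurable (J i)) (p : V → ℝ)
    (h : ∀ (k : ℕ) (x : ℕ → V),
      P.real {ω | ∀ i ≤ k, J i ω = x i} = ∏ i ∈ Finset.range (k + 1), p (x i)) :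
    iIndepFun J P ∧ ∀ i, P.map (J i) = P.map (J 0) := by
  have : IsProbabilityMeasure (P.map (J 0)) :=
    Measure.isProbabilityMeasure_map (mJ 0).aemeasurable
  have h0 : ∀ x, (P.map (J 0)).real {x} = p x := by
    intro x
    rw [map_measureReal_apply (mJ 0) (measurableSet_singleton x)]
    have := h 0 fun _ => x
    simp only [nonpos_iff_eq_zero, forall_eq, zero_add, Finset.range_one,
      Finset.prod_singleton] at this
    exact this
  have mJ' : Measurable fun ω i => J i ω := measurable_pi_lambda _ mJ
  have law : P.map (fun ω i => J i ω) = Measure.infinitePi fun _ : ℕ => P.map (J 0) := by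
    refine ((Measure.isProjectiveLimit_infinitePi _).unique
      ((isProjectiveLimit_nat_iff
        (isProjectiveMeasureFamily_pi _) _).2 fun n => ?_)).symm
    rw [Measure.map_map (by fun_prop) mJ']
    refine Measure.ext_of_singleton fun x => ?_
    -- The value `x 0` beyond index `n` is a mere filler: the event only involves indices up to `n`.
    have hx : (Preorder.frestrictLe n ∘ fun ω i => J i ω) ⁻¹' {x} =
        {ω | ∀ i ≤ n, J i ω = (fun i => if hi : i ∈ Finset.Iic n then x ⟨i, hi⟩ else
          x ⟨0, by simp⟩) i} := by
      ext ω
      simp only [Set.mem_preimage, Set.mem_singleton_iff, Set.mem_ofPred_eq, funext_iff,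
        Subtype.forall, Finset.mem_Iic]
      refine forall_congr' fun i => forall_congr' fun hi => ?_
      simp [hi]
    rw [Measure.map_apply ((by fun_prop : Measurable (Preorder.frestrictLe n)).comp mJ')
      (measurableSet_singleton x), hx, Measure.pi_singleton, ← ENNReal.toReal_eq_toReal_iff'
      (measure_ne_top _ _) (ENNReal.prod_ne_top fun i _ => measure_ne_top _ _),
      ENNReal.toReal_prod]
    refine (h _ _).trans ?_
    simp only [← Measure.real_def, h0]
    rw [Nat.range_succ_eq_Iic, ← Finset.prod_coe_sort]
    refine Finset.prod_congr rfl fun i _ => ?_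
    rw [dif_pos i.2]
  have hi : ∀ i, P.map (J i) = P.map (J 0) := by
    intro i
    rw [← Measure.infinitePi_map_eval (fun _ : ℕ => P.map (J 0)) i, ← law,
      Measure.map_map (measurable_pi_apply i) mJ']
    rfl
  exact ⟨(iIndepFun_iff_map_fun_eq_infinitePi_map mJ).2 (by simp only [hi, law]), hi⟩

end Independence
/-! ### The increments of the clock process -/

/-- The probability that the holding time at a site of depth `t`, divided by the time scale `c`,
belongs to `B`. -/
noncomputable def holdProb (a c : ℝ) (B : Set ℝ) (t : ℝ) : ℝ :=
  (expMeasure 1).real {s | c⁻¹ * (t ^ (-(1 - a)))⁻¹ * s ∈ B}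

instance isProbabilityMeasure_expMeasure_one : IsProbabilityMeasure (expMeasure 1) :=
  isProbabilityMeasure_expMeasure one_pos

theorem holdProb_nonneg (a c : ℝ) (B : Set ℝ) (t : ℝ) : 0 ≤ holdProb a c B t :=
  measureReal_nonneg

theorem holdProb_le_one (a c : ℝ) (B : Set ℝ) (t : ℝ) : holdProb a c B t ≤ 1 :=
  measureReal_le_one

theorem measurable_holdProb (a c : ℝ) {B : Set ℝ} (hB : MeasurableSet B) :
    Measurable (holdProb a c B) := by
  have h : MeasurableSet {p : ℝ × ℝ | c⁻¹ * (p.1 ^ (-(1 - a)))⁻¹ * p.2 ∈ B} := by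
    have : Measurable fun p : ℝ × ℝ => c⁻¹ * (p.1 ^ (-(1 - a)))⁻¹ * p.2 := by fun_prop
    exact this hB
  exact (measurable_measure_prodMk_left h).ennreal_toReal

theorem measureReal_expMeasure_Iic {x : ℝ} (hx : 0 ≤ x) :
    (expMeasure 1).real (Set.Iic x) = 1 - Real.exp (-x) := by
  rw [← cdf_eq_real, cdf_expMeasure_eq one_pos, if_pos hx, one_mul]

theorem setOf_scale_le {a c : ℝ} (hc : 0 < c) {t : ℝ} (ht : 0 < t) (u : ℝ) :
    {s : ℝ | c⁻¹ * (t ^ (-(1 - a)))⁻¹ * s ∈ Set.Iic u} =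
      Set.Iic (u * (c * t ^ (-(1 - a)))) := by
  ext s
  have h : 0 < c * t ^ (-(1 - a)) := mul_pos hc (Real.rpow_pos_of_pos ht _)
  rw [← mul_inv]
  simp only [Set.mem_ofPred_eq, Set.mem_Iic]
  rw [inv_mul_le_iff₀ h, mul_comm]

theorem holdProb_Iic {a c : ℝ} (hc : 0 < c) {t : ℝ} (ht : 0 < t) {u : ℝ} (hu : 0 ≤ u) :
    holdProb a c (Set.Iic u) t = 1 - Real.exp (-(u * (c * t ^ (-(1 - a))))) := by
  rw [holdProb, setOf_scale_le hc ht, measureReal_expMeasure_Iic]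
  exact mul_nonneg hu (mul_pos hc (Real.rpow_pos_of_pos ht _)).le

theorem holdProb_Ioi {a c : ℝ} (hc : 0 < c) {t : ℝ} (ht : 0 < t) {u : ℝ} (hu : 0 ≤ u) :
    holdProb a c (Set.Ioi u) t = Real.exp (-(u * (c * t ^ (-(1 - a))))) := by
  have h : {s : ℝ | c⁻¹ * (t ^ (-(1 - a)))⁻¹ * s ∈ Set.Ioi u} =
      {s : ℝ | c⁻¹ * (t ^ (-(1 - a)))⁻¹ * s ∈ Set.Iic u}ᶜ := by
    ext; simp
  rw [holdProb, h, setOf_scale_le hc ht, probReal_compl_eq_one_sub measurableSet_Iic,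
    measureReal_expMeasure_Iic (mul_nonneg hu (mul_pos hc (Real.rpow_pos_of_pos ht _)).le)]
  ring

section Increments

variable {V : Type*} [Fintype V] [MeasurableSpace V] [DiscreteMeasurableSpace V] {a : ℝ}
  {τ : V → ℝ} {Y : Type*} [MeasurableSpace Y]

/-- The jumps of the clock process with time scale `c`. -/
noncomputable def Dynamics.increment {μ : V → ℝ} (D : Dynamics a τ μ Y) (c : ℝ) (i : ℕ) (y : Y) :
    ℝ :=
  c⁻¹ * (holdRate a τ (D.J i y))⁻¹ * D.e i y

theorem Dynamics.measurable_increment {μ : V → ℝ} (D : Dynamics a τ μ Y) (c : ℝ) (i : ℕ) :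
    Measurable (D.increment c i) :=
  ((((measurable_of_countable (holdRate a τ)).comp (D.measurable_J i)).inv).const_mul _).mul
    (D.measurable_e i)

omit [DiscreteMeasurableSpace V] in
theorem Dynamics.clock_natCast {μ : V → ℝ} (D : Dynamics a τ μ Y) (c : ℝ) (k : ℕ) (y : Y) :
    D.clock 1 c k y = ∑ i ∈ Finset.Icc 1 k, D.increment c i y := by
  simp [clock, partialSum, increment, Finset.mul_sum, mul_assoc]

variable (D : Dynamics a τ (invMeas a τ) Y)

theorem Dynamics.iIndepFun_J :
    iIndepFun D.J (D.prob : Measure Y) ∧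
      ∀ i, (D.prob : Measure Y).map (D.J i) = (D.prob : Measure Y).map (D.J 0) := by
  refine iIndepFun_of_measureReal_eq_prod D.measurable_J (invMeas a τ) fun k x => ?_
  rw [D.chain k x, Finset.prod_range_succ', mul_comm]
  rfl

theorem Dynamics.map_J_e (i : ℕ) :
    (D.prob : Measure Y).map (fun y => (D.J i y, D.e i y)) =
      ((D.prob : Measure Y).map (D.J 0)).prod (expMeasure 1) := by
  have h : IndepFun (D.J i) (D.e i) (D.prob : Measure Y) :=
    D.indep_J_e.comp (measurable_pi_apply i) (measurable_pi_apply i)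
  rw [(indepFun_iff_map_prod_eq_prod_map_map (D.measurable_J i).aemeasurable
    (D.measurable_e i).aemeasurable).1 h, D.law_e, D.iIndepFun_J.2 i]

theorem measurable_scale (c : ℝ) :
    Measurable fun p : V × ℝ => c⁻¹ * (holdRate a τ p.1)⁻¹ * p.2 :=
  ((((measurable_of_countable (holdRate a τ)).comp measurable_fst).inv).const_mul _).mul
    measurable_snd

theorem Dynamics.map_increment (c : ℝ) (i : ℕ) :
    (D.prob : Measure Y).map (D.increment c i) =
      (((D.prob : Measure Y).map (D.J 0)).prod (expMeasure 1)).map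
        fun p => c⁻¹ * (holdRate a τ p.1)⁻¹ * p.2 := by
  rw [← D.map_J_e i, Measure.map_map (measurable_scale c)
    ((D.measurable_J i).prodMk (D.measurable_e i))]
  rfl

theorem Dynamics.iIndepFun_increment (c : ℝ) :
    iIndepFun (D.increment c) (D.prob : Measure Y) :=
  (iIndepFun_prodMk D.measurable_J D.measurable_e D.iIndepFun_J.1 D.indep_e
    D.indep_J_e).comp (fun _ p => c⁻¹ * (holdRate a τ p.1)⁻¹ * p.2) fun _ => measurable_scale c

/-- The law of the jumps of the clock process. -/
noncomputable def Dynamics.incrementLaw (c : ℝ) : ProbabilityMeasure ℝ :=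
  D.prob.map (D.measurable_increment c 0).aemeasurable

theorem Dynamics.map_increment_eq_incrementLaw (c : ℝ) (i : ℕ) :
    (D.prob : Measure Y).map (D.increment c i) = D.incrementLaw c := by
  rw [D.map_increment, ← D.map_increment c 0]
  rfl

/-- Conditioning on the visited vertex turns the increment law into an average over the landscape,
to which laws of large numbers apply. -/
theorem Dynamics.incrementLaw_real (c : ℝ) {B : Set ℝ} (hB : MeasurableSet B) :
    (D.incrementLaw c : Measure ℝ).real B = ∑ x, invMeas a τ x * holdProb a c B (τ x) := by
  have h0 : ∀ x, ((D.prob : Measure Y).map (D.J 0)).real {x} = invMeas a τ x := by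
    intro x
    rw [map_measureReal_apply (D.measurable_J 0) (measurableSet_singleton x)]
    have h := D.chain 0 fun _ => x
    simp only [nonpos_iff_eq_zero, forall_eq, Finset.range_zero, Finset.prod_empty, mul_one] at h
    exact h
  have : IsProbabilityMeasure ((D.prob : Measure Y).map (D.J 0)) :=
    Measure.isProbabilityMeasure_map (D.measurable_J 0).aemeasurable
  rw [← D.map_increment_eq_incrementLaw c 0, D.map_increment, measureReal_def,
    Measure.map_apply (measurable_scale c) hB, Measure.prod_apply (measurable_scale c hB),
    lintegral_fintype, ENNReal.toReal_sum fun x _ =>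
      ENNReal.mul_ne_top (measure_ne_top _ _) (measure_ne_top _ _)]
  refine Finset.sum_congr rfl fun x _ => ?_
  rw [ENNReal.toReal_mul, ← measureReal_def, ← measureReal_def, h0, mul_comm]
  rfl

theorem Dynamics.clockLaw_eq_renewalLaw (c : ℝ) :
    D.clockLaw c = renewalLaw (D.incrementLaw c) := by
  refine Subtype.ext ?_
  refine Eq.trans ?_ (map_partialSums_eq_renewalLaw (D.measurable_increment c)
    (D.iIndepFun_increment c) (D.incrementLaw c) (D.map_increment_eq_incrementLaw c))
  simp only [← D.clock_natCast]
  rfl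

/-- The law of the jumps of the clock process, as a law on `[0, ∞]`. -/
noncomputable def Dynamics.incrementLawExt (c : ℝ) : ProbabilityMeasure ℝ≥0∞ :=
  (D.incrementLaw c).map ENNReal.measurable_ofReal.aemeasurable

-- Needed because `ENNReal.ofReal` commutes with sums only for nonnegative terms, and exponential
-- variables are nonnegative only almost surely.
omit [DiscreteMeasurableSpace V] in
theorem Dynamics.ae_increment_nonneg {c : ℝ} (hc : 0 < c) (hτ : ∀ x, 0 < τ x) :
    ∀ᵐ y ∂(D.prob : Measure Y), ∀ i, 0 ≤ D.increment c i y := by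
  refine ae_all_iff.2 fun i => ?_
  have h : ∀ᵐ s ∂(D.prob : Measure Y).map (D.e i), 0 < s := by
    rw [D.law_e, ae_iff, ← measureReal_eq_zero_iff]
    have := measureReal_expMeasure_Iic le_rfl
    simp only [neg_zero, Real.exp_zero, sub_self] at this
    simpa [Set.Iic] using this
  filter_upwards [ae_of_ae_map (D.measurable_e i).aemeasurable h] with y hy
  have := Real.rpow_pos_of_pos (hτ (D.J i y)) (-(1 - a))
  unfold increment holdRate
  positivity

theorem Dynamics.clockLawExt_eq_renewalLaw {c : ℝ} (hc : 0 < c) (hτ : ∀ x, 0 < τ x) :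
    D.clockLawExt c = renewalLaw (D.incrementLawExt c) := by
  refine Subtype.ext ?_
  have hm : ∀ i, Measurable fun y => ENNReal.ofReal (D.increment c i y) := fun i =>
    (D.measurable_increment c i).ennreal_ofReal
  refine Eq.trans ?_ (map_partialSums_eq_renewalLaw hm
    ((D.iIndepFun_increment c).comp (fun _ => ENNReal.ofReal) fun _ => ENNReal.measurable_ofReal)
    (D.incrementLawExt c) fun i => ?_)
  · refine Measure.map_congr ?_
    filter_upwards [D.ae_increment_nonneg hc hτ] with y hy
    funext k
    rw [D.clock_natCast, ENNReal.ofReal_sum_of_nonneg fun i _ => hy i]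
  · have : (D.incrementLawExt c : Measure ℝ≥0∞) =
      (D.incrementLaw c : Measure ℝ).map ENNReal.ofReal := rfl
    rw [this, ← D.map_increment_eq_incrementLaw c i,
      Measure.map_map ENNReal.measurable_ofReal (D.measurable_increment c i)]
    rfl

end Increments
/-! ### Moments of laws with regularly varying tails -/

section Tail

variable {α : ℝ} {ρ : Measure ℝ}

theorem InDomain.eventually_pos (h : InDomain α ρ) : ∀ᶠ u in atTop, 0 < ρ.real (Set.Ioi u) := by
  obtain ⟨L, ⟨hL, -⟩, hρ⟩ := h
  filter_upwards [hL, eventually_gt_atTop 0] with u hu hu0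
  rw [hρ u hu0]
  exact mul_pos (Real.rpow_pos_of_pos hu0 _) hu

theorem InDomain.tendsto_tail_ratio (h : InDomain α ρ) :
    Tendsto (fun u => ρ.real (Set.Ioi (2 * u)) / ρ.real (Set.Ioi u)) atTop (𝓝 (2 ^ (-α))) := by
  obtain ⟨L, ⟨-, hL⟩, hρ⟩ := h
  have := (hL 2 two_pos).const_mul ((2 : ℝ) ^ (-α))
  rw [mul_one] at this
  refine this.congr' ?_
  filter_upwards [eventually_gt_atTop 0] with u hu
  have hu' := (Real.rpow_pos_of_pos hu (-α)).ne'
  rw [hρ u hu, hρ (2 * u) (by positivity), Real.mul_rpow two_pos.le hu.le]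
  field_simp

/-- A dyadic Potter bound: the tail ratio over a doubling tends to `2 ^ (-α) < 2 ^ (-β)`, so beyond
some point each doubling costs at least a factor `2 ^ (-β)`. -/
theorem InDomain.exists_tail_le [IsProbabilityMeasure ρ] (h : InDomain α ρ) {β : ℝ} (hβ : β < α) :
    ∃ u : ℝ, 0 < u ∧ ∀ k : ℕ, ρ.real (Set.Ioi (2 ^ k * u)) ≤ ((2 : ℝ) ^ (-β)) ^ k := by
  have h2 : (2 : ℝ) ^ (-α) < 2 ^ (-β) :=
    Real.rpow_lt_rpow_of_exponent_lt one_lt_two (neg_lt_neg hβ)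
  obtain ⟨N, hN⟩ := eventually_atTop.1
    (h.eventually_pos.and (h.tendsto_tail_ratio.eventually (gt_mem_nhds h2)))
  refine ⟨max N 1, by positivity, fun k => ?_⟩
  induction k with
  | zero => simp
  | succ k ih =>
    have hk : N ≤ 2 ^ k * max N 1 :=
      (le_max_left N 1).trans (le_mul_of_one_le_left (by positivity) (one_le_pow₀ one_le_two))
    obtain ⟨hpos, hr⟩ := hN _ hk
    rw [div_lt_iff₀ hpos, ← mul_assoc, ← pow_succ'] at hr
    rw [pow_succ' ((2 : ℝ) ^ (-β))]
    exact hr.le.trans (by gcongr)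

/-- With `α < β < a`, each doubling of a large `u` multiplies the tail by at least `2 ^ (-β)` and `u
^ a` by `2 ^ a`, so the product grows geometrically. -/
theorem InDomain.exists_lt_rpow_mul_tail (h : InDomain α ρ) {a : ℝ} (ha : α < a)
    (C : ℝ) : ∃ u : ℝ, 0 < u ∧ C < u ^ a * ρ.real (Set.Ioi u) := by
  obtain ⟨β, hαβ, hβa⟩ := exists_between ha
  have h2 : (2 : ℝ) ^ (-β) < 2 ^ (-α) :=
    Real.rpow_lt_rpow_of_exponent_lt one_lt_two (neg_lt_neg hαβ)
  obtain ⟨N, hN⟩ := eventually_atTop.1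
    (h.eventually_pos.and (h.tendsto_tail_ratio.eventually (lt_mem_nhds h2)))
  set v := max N 1 with hv
  have hv0 : 0 < v := by positivity
  have key : ∀ k : ℕ, ((2 : ℝ) ^ (-β)) ^ k * ρ.real (Set.Ioi v) ≤
      ρ.real (Set.Ioi (2 ^ k * v)) := by
    intro k
    induction k with
    | zero => simp
    | succ k ih =>
      have hk : N ≤ 2 ^ k * v :=
        (le_max_left N 1).trans (le_mul_of_one_le_left hv0.le (one_le_pow₀ one_le_two))
      obtain ⟨hpos, hr⟩ := hN _ hk
      rw [lt_div_iff₀ hpos, ← mul_assoc, ← pow_succ'] at hr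
      refine le_trans ?_ hr.le
      rw [pow_succ', mul_assoc]
      gcongr
  have hT : 0 < ρ.real (Set.Ioi v) := (hN v (le_max_left _ _)).1
  have hq : 1 < (2 : ℝ) ^ a * 2 ^ (-β) := by
    rw [← Real.rpow_add two_pos]
    exact Real.one_lt_rpow one_lt_two (by linarith)
  have hlim : Tendsto (fun k : ℕ => ((2 : ℝ) ^ a * 2 ^ (-β)) ^ k *
      (v ^ a * ρ.real (Set.Ioi v))) atTop atTop :=
    (tendsto_pow_atTop_atTop_of_one_lt hq).atTop_mul_const
      (mul_pos (Real.rpow_pos_of_pos hv0 _) hT)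
  obtain ⟨k, hk⟩ := (hlim.eventually_gt_atTop C).exists
  refine ⟨2 ^ k * v, by positivity, hk.trans_le ?_⟩
  rw [Real.mul_rpow (by positivity) hv0.le, ← Real.rpow_pow_comm two_pos.le, mul_pow]
  calc _ = ((2 : ℝ) ^ a) ^ k * v ^ a * (((2 : ℝ) ^ (-β)) ^ k * ρ.real (Set.Ioi v)) := by ring
    _ ≤ _ := by gcongr; exact key k

theorem InDomain.integrable_rpow {Ω : Type*} [MeasurableSpace Ω] {P : Measure Ω}
    [IsProbabilityMeasure P] {X : Ω → ℝ} (hX : Measurable X) (hX0 : ∀ ω, 0 < X ω)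
    (h : InDomain α (P.map X)) {a : ℝ} (ha0 : 0 ≤ a) (ha : a < α) :
    Integrable (fun ω => X ω ^ a) P := by
  have : IsProbabilityMeasure (P.map X) := Measure.isProbabilityMeasure_map hX.aemeasurable
  obtain ⟨β, haβ, hβα⟩ := exists_between ha
  obtain ⟨u, hu, hT⟩ := h.exists_tail_le hβα
  have hmeas : Measurable fun ω => X ω ^ a := hX.pow_const a
  refine ⟨hmeas.aestronglyMeasurable, ?_⟩
  rw [hasFiniteIntegral_iff_ofReal (ae_of_all _ fun ω => (Real.rpow_pos_of_pos (hX0 ω) a).le)]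
  have hset : ∀ k : ℕ, MeasurableSet {ω | 2 ^ k * u < X ω} := fun k =>
    measurableSet_lt measurable_const hX
  have hP : ∀ k : ℕ, P {ω | 2 ^ k * u < X ω} ≤ ENNReal.ofReal (((2 : ℝ) ^ (-β)) ^ k) := by
    intro k
    rw [← ofReal_measureReal]
    refine ENNReal.ofReal_le_ofReal ?_
    have := hT k
    rwa [map_measureReal_apply hX measurableSet_Ioi] at this
  -- When `X > 2u`, some `k` satisfies `2^k * 2u ≤ X < 2^(k+1) * 2u`, and that single term
  -- dominates. The factor 2 in `2u` makes `2^k * u < X` strict.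
  have hpt : ∀ ω, ENNReal.ofReal (X ω ^ a) ≤ ENNReal.ofReal ((2 * u) ^ a) +
      ∑' k : ℕ, Set.indicator {ω | 2 ^ k * u < X ω}
        (fun _ => ENNReal.ofReal ((2 ^ k * (4 * u)) ^ a)) ω := by
    intro ω
    by_cases hω : X ω ≤ 2 * u
    · exact (ENNReal.ofReal_le_ofReal (Real.rpow_le_rpow (hX0 ω).le hω ha0)).trans le_self_add
    · obtain ⟨k, hk1, hk2⟩ := exists_nat_pow_near (x := X ω / (2 * u)) (y := 2)
        (by rw [le_div_iff₀ (by positivity)]; linarith) one_lt_two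
      rw [div_lt_iff₀ (by positivity)] at hk2
      rw [le_div_iff₀ (by positivity)] at hk1
      refine le_trans ?_ le_add_self
      refine le_trans ?_ (ENNReal.le_tsum k)
      have hk : 0 < 2 ^ k * u := by positivity
      have hmem : ω ∈ {ω | 2 ^ k * u < X ω} := show 2 ^ k * u < X ω by linarith
      rw [Set.indicator_of_mem hmem]
      exact ENNReal.ofReal_le_ofReal (Real.rpow_le_rpow (hX0 ω).le
        (hk2.le.trans_eq (by ring)) ha0)
  have hq0 : 0 ≤ (2 : ℝ) ^ a * 2 ^ (-β) := by positivity
  have hq : (2 : ℝ) ^ a * 2 ^ (-β) < 1 := by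
    rw [← Real.rpow_add two_pos]
    exact Real.rpow_lt_one_of_one_lt_of_neg one_lt_two (by linarith)
  have hterm : ∀ k : ℕ, ∫⁻ ω, Set.indicator {ω | 2 ^ k * u < X ω}
      (fun _ => ENNReal.ofReal ((2 ^ k * (4 * u)) ^ a)) ω ∂P ≤
      ENNReal.ofReal ((4 * u) ^ a * ((2 : ℝ) ^ a * 2 ^ (-β)) ^ k) := by
    intro k
    rw [lintegral_indicator_const (hset k)]
    refine (mul_le_mul_right (hP k) _).trans_eq ?_
    rw [← ENNReal.ofReal_mul (by positivity), Real.mul_rpow (by positivity) (by positivity),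
      ← Real.rpow_pow_comm two_pos.le, mul_pow]
    congr 1
    ring
  calc ∫⁻ ω, ENNReal.ofReal (X ω ^ a) ∂P
      ≤ ∫⁻ ω, (ENNReal.ofReal ((2 * u) ^ a) + ∑' k : ℕ, Set.indicator {ω | 2 ^ k * u < X ω}
        (fun _ => ENNReal.ofReal ((2 ^ k * (4 * u)) ^ a)) ω) ∂P := lintegral_mono hpt
    _ = ENNReal.ofReal ((2 * u) ^ a) + ∑' k : ℕ, ∫⁻ ω, Set.indicator {ω | 2 ^ k * u < X ω}
        (fun _ => ENNReal.ofReal ((2 ^ k * (4 * u)) ^ a)) ω ∂P := by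
      rw [lintegral_add_left measurable_const, lintegral_const, measure_univ, mul_one,
        lintegral_tsum fun k => (measurable_const.indicator (hset k)).aemeasurable]
    _ ≤ ENNReal.ofReal ((2 * u) ^ a) +
        ∑' k : ℕ, ENNReal.ofReal ((4 * u) ^ a * ((2 : ℝ) ^ a * 2 ^ (-β)) ^ k) := by
      gcongr with k
      exact hterm k
    _ < ∞ := by
      rw [← ENNReal.ofReal_tsum_of_nonneg (fun k => by positivity)
        ((summable_geometric_of_lt_one hq0 hq).mul_left _)]
      exact ENNReal.add_lt_top.2 ⟨ENNReal.ofReal_lt_top, ENNReal.ofReal_lt_top⟩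

end Tail
/-! ### The jumps in a random landscape -/

section Landscape

variable {Ω : Type*} [MeasurableSpace Ω] {P : Measure Ω} {τ : ℕ → Ω → ℝ}

/-- The strong law of large numbers for a function of the landscape. -/
theorem ae_tendsto_average (hindep : iIndepFun τ P)
    (hident : ∀ x, IdentDistrib (τ x) (τ 0) P P) {φ : ℝ → ℝ} (hφ : Measurable φ)
    (hint : Integrable (fun ω => φ (τ 0 ω)) P) :
    ∀ᵐ ω ∂P, Tendsto (fun n : ℕ => (∑ x : Fin (n + 1), φ (τ x ω)) / ((n + 1 : ℕ) : ℝ)) atTop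
      (𝓝 (∫ ω, φ (τ 0 ω) ∂P)) := by
  have := strong_law_ae_real (fun x ω => φ (τ x ω)) hint
    (fun i j hij => (hindep.indepFun hij).comp hφ hφ) fun i => (hident i).comp hφ
  filter_upwards [this] with ω hω
  refine (hω.comp (tendsto_add_atTop_nat 1)).congr fun n => ?_
  simp only [Function.comp_apply, ← Fin.sum_univ_eq_sum_range (fun i => φ (τ i ω))]

theorem sum_invMeas_mul {V : Type*} [Fintype V] (a : ℝ) (τ : V → ℝ) (h : ℝ → ℝ) :
    ∑ x, invMeas a τ x * h (τ x) = (∑ x, τ x ^ a * h (τ x)) / ∑ x, τ x ^ a := by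
  rw [Finset.sum_div]
  exact Finset.sum_congr rfl fun x _ => by rw [invMeas]; ring

/-- If `𝔼 τ ^ a < ∞`, averages against the measure `π` converge. -/
theorem ae_tendsto_sum_invMeas (hmeas : Measurable (τ 0)) (hpos : ∀ x ω, 0 < τ x ω)
    (hindep : iIndepFun τ P)
    (hident : ∀ x, IdentDistrib (τ x) (τ 0) P P) [IsProbabilityMeasure P] {a : ℝ}
    (hint : Integrable (fun ω => τ 0 ω ^ a) P)
    {h : ℝ → ℝ} (hh : Measurable h) (h0 : ∀ t, 0 ≤ h t) (h1 : ∀ t, h t ≤ 1) :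
    ∀ᵐ ω ∂P, Tendsto (fun n : ℕ => ∑ x : Fin (n + 1),
      invMeas a (fun x : Fin (n + 1) => τ x ω) x * h (τ x ω)) atTop
      (𝓝 ((∫ ω, τ 0 ω ^ a * h (τ 0 ω) ∂P) / ∫ ω, τ 0 ω ^ a ∂P)) := by
  have hE : 0 < ∫ ω, τ 0 ω ^ a ∂P := by
    rw [integral_pos_iff_support_of_nonneg
      (fun ω => (Real.rpow_pos_of_pos (hpos 0 ω) a).le) hint]
    have : Function.support (fun ω => τ 0 ω ^ a) = Set.univ :=
      Set.eq_univ_of_forall fun ω => (Real.rpow_pos_of_pos (hpos 0 ω) a).ne'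
    simp [this]
  have hm : Measurable fun t : ℝ => t ^ a := measurable_id.pow_const a
  have hint' : Integrable (fun ω => τ 0 ω ^ a * h (τ 0 ω)) P := by
    refine hint.mono ((hm.comp hmeas).mul (hh.comp hmeas)).aestronglyMeasurable
      (ae_of_all _ fun ω => ?_)
    rw [norm_mul, Real.norm_of_nonneg (h0 _)]
    exact mul_le_of_le_one_right (norm_nonneg _) (h1 _)
  filter_upwards [ae_tendsto_average hindep hident (hm.mul hh) hint',
    ae_tendsto_average hindep hident hm hint] with ω hω1 hω2
  refine (hω1.div hω2 hE.ne').congr fun n => ?_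
  have := sum_invMeas_mul a (fun x : Fin (n + 1) => τ x ω) h
  rw [this, Pi.div_apply, div_div_div_cancel_right₀ (by positivity)]
  rfl

/-- The bounded minorant `u^a 1{τ > u}` of `τ^a` has mean `u^a P(τ > u)`, which can be made larger
than any constant; the strong law applies to it. -/
theorem ae_tendsto_sum_rpow_atTop [IsProbabilityMeasure P] (hmeas : Measurable (τ 0))
    (hpos : ∀ x ω, 0 < τ x ω)
    (hindep : iIndepFun τ P) (hident : ∀ x, IdentDistrib (τ x) (τ 0) P P) {α a : ℝ}
    (ha0 : 0 ≤ a) (ha : α < a) (htail : InDomain α (P.map (τ 0))) :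
    ∀ᵐ ω ∂P, Tendsto (fun n : ℕ => (∑ x : Fin (n + 1), τ x ω ^ a) / ((n + 1 : ℕ) : ℝ))
      atTop atTop := by
  have key : ∀ C : ℕ, ∀ᵐ ω ∂P, ∀ᶠ n : ℕ in atTop,
      (C : ℝ) ≤ (∑ x : Fin (n + 1), τ x ω ^ a) / ((n + 1 : ℕ) : ℝ) := by
    intro C
    obtain ⟨u, hu, hC⟩ := htail.exists_lt_rpow_mul_tail ha C
    have hφ : Measurable (Set.indicator (Set.Ioi u) fun _ : ℝ => u ^ a) :=
      measurable_const.indicator measurableSet_Ioi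
    have hset : MeasurableSet (τ 0 ⁻¹' Set.Ioi u) := hmeas measurableSet_Ioi
    have heq : (fun ω => Set.indicator (Set.Ioi u) (fun _ : ℝ => u ^ a) (τ 0 ω)) =
        Set.indicator (τ 0 ⁻¹' Set.Ioi u) fun _ => u ^ a := rfl
    have hint : Integrable (fun ω => Set.indicator (Set.Ioi u) (fun _ : ℝ => u ^ a) (τ 0 ω)) P := by
      rw [heq]
      exact (integrable_const _).indicator hset
    have hval : ∫ ω, Set.indicator (Set.Ioi u) (fun _ : ℝ => u ^ a) (τ 0 ω) ∂P =
        u ^ a * (P.map (τ 0)).real (Set.Ioi u) := by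
      rw [heq, integral_indicator_const _ hset, smul_eq_mul, mul_comm,
        map_measureReal_apply hmeas measurableSet_Ioi]
    filter_upwards [ae_tendsto_average hindep hident hφ hint] with ω hω
    rw [hval] at hω
    filter_upwards [hω.eventually (lt_mem_nhds hC)] with n hn
    refine hn.le.trans ?_
    gcongr with x
    by_cases hx : τ x ω ∈ Set.Ioi u
    · rw [Set.indicator_of_mem hx]
      exact Real.rpow_le_rpow hu.le (le_of_lt hx) ha0
    · rw [Set.indicator_of_notMem hx]
      exact (Real.rpow_pos_of_pos (hpos x ω) a).le
  filter_upwards [ae_all_iff.2 key] with ω hω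
  refine tendsto_atTop.2 fun b => ?_
  obtain ⟨C, hC⟩ := exists_nat_ge b
  filter_upwards [hω C] with n hn using hC.trans hn

/-- If the average of `τ ^ a` diverges, the measure `π` charges only the deep traps. -/
theorem tendsto_sum_invMeas_of_tendsto_atTop {t : ℕ → ℝ} (ht : ∀ x, 0 < t x) {a : ℝ} (ha0 : 0 ≤ a)
    (hdiv : Tendsto (fun n : ℕ => (∑ x : Fin (n + 1), t x ^ a) / ((n + 1 : ℕ) : ℝ)) atTop atTop)
    {h : ℝ → ℝ} (h0 : ∀ t, 0 ≤ h t) (h1 : ∀ t, h t ≤ 1) (hlim : Tendsto h atTop (𝓝 0)) :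
    Tendsto (fun n : ℕ => ∑ x : Fin (n + 1),
      invMeas a (fun x : Fin (n + 1) => t x) x * h (t x)) atTop (𝓝 0) := by
  have hp : ∀ x, 0 < t x ^ a := fun x => Real.rpow_pos_of_pos (ht x) a
  have hS : ∀ n : ℕ, 0 < ∑ x : Fin (n + 1), t x ^ a := fun n =>
    Finset.sum_pos (fun x _ => hp x) Finset.univ_nonempty
  rw [Metric.tendsto_atTop']
  intro ε hε
  obtain ⟨N, hN⟩ := eventually_atTop.1 (hlim.eventually (gt_mem_nhds (half_pos hε)))
  set M := max N 1
  have hM : 0 < M := by positivity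
  obtain ⟨n₀, hn₀⟩ := eventually_atTop.1 (hdiv.eventually_gt_atTop (M ^ a / (ε / 2)))
  refine ⟨n₀, fun n hn => ?_⟩
  have hn := hn₀ n hn.le
  have hnn : 0 ≤ (∑ x : Fin (n + 1), t x ^ a * h (t x)) / ∑ x : Fin (n + 1), t x ^ a :=
    div_nonneg (Finset.sum_nonneg fun x _ => mul_nonneg (hp x).le (h0 _)) (hS n).le
  rw [sum_invMeas_mul a (fun x : Fin (n + 1) => t x) h, Real.dist_0_eq_abs, abs_of_nonneg hnn,
    div_lt_iff₀ (hS n)]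
  rw [div_lt_div_iff₀ (half_pos hε) (by positivity)] at hn
  -- Sites of depth at least `M` have `h ≤ ε / 2`. The others contribute at most `M ^ a` each, a
  -- total below `ε / 2 * ∑ τ^a` by the choice of `n₀`.
  have hx : ∀ x : ℕ, t x ^ a * h (t x) ≤ ε / 2 * t x ^ a + M ^ a := by
    intro x
    rcases le_total (t x) M with hx | hx
    · have h3 : t x ^ a ≤ M ^ a := Real.rpow_le_rpow (ht x).le hx ha0
      have h4 : t x ^ a * h (t x) ≤ t x ^ a := mul_le_of_le_one_right (hp x).le (h1 _)
      have h5 : 0 ≤ ε / 2 * t x ^ a := by have := hp x; positivity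
      linarith
    · have h3 : h (t x) ≤ ε / 2 := (hN _ ((le_max_left N 1).trans hx)).le
      have h4 : 0 < M ^ a := Real.rpow_pos_of_pos hM a
      nlinarith [hp x]
  calc ∑ x : Fin (n + 1), t x ^ a * h (t x)
      ≤ ∑ x : Fin (n + 1), (ε / 2 * t x ^ a + M ^ a) := Finset.sum_le_sum fun x _ => hx x
    _ = ε / 2 * ∑ x : Fin (n + 1), t x ^ a + M ^ a * ((n + 1 : ℕ) : ℝ) := by
      rw [Finset.sum_add_distrib, ← Finset.mul_sum]
      simp [mul_comm]
    _ < ε * ∑ x : Fin (n + 1), t x ^ a := by linarith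

end Landscape

theorem tendsto_holdProb_Iic {a c : ℝ} (ha1 : a < 1) (hc : 0 < c) {u : ℝ} (hu : 0 ≤ u) :
    Tendsto (holdProb a c (Set.Iic u)) atTop (𝓝 0) := by
  have h1 : Tendsto (fun t : ℝ => 1 - Real.exp (-(u * (c * t ^ (-(1 - a)))))) atTop
      (𝓝 (1 - Real.exp (-(u * (c * 0))))) := by
    refine tendsto_const_nhds.sub ((Real.continuous_exp.tendsto _).comp
      (Tendsto.neg (Tendsto.const_mul u (Tendsto.const_mul c ?_))))
    exact tendsto_rpow_neg_atTop (by linarith)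
  simp only [mul_zero, neg_zero, Real.exp_zero, sub_self] at h1
  refine h1.congr' ?_
  filter_upwards [eventually_gt_atTop 0] with t ht using (holdProb_Iic hc ht hu).symm

/-! ### Weak convergence of the law of the jumps -/

/-- Countably many test intervals suffice, so almost sure statements for each interval combine on
one event. -/
theorem tendsto_of_forall_Ioo_rat {ι : Type*} {l : Filter ι} [l.IsCountablyGenerated]
    {μ : ι → ProbabilityMeasure ℝ} {ν : ProbabilityMeasure ℝ}
    (h : ∀ p q : ℚ, Tendsto (fun i => (μ i : Measure ℝ).real (Set.Ioo p q)) l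
      (𝓝 ((ν : Measure ℝ).real (Set.Ioo p q)))) :
    Tendsto μ l (𝓝 ν) := by
  refine Real.isPiSystem_Ioo_rat.tendsto_probabilityMeasure_of_tendsto_of_mem ?_ ?_ ?_
  · intro s hs
    simp only [Set.mem_iUnion, Set.mem_singleton_iff] at hs
    obtain ⟨p, q, -, rfl⟩ := hs
    exact measurableSet_Ioo
  · intro u hu x hx
    obtain ⟨s, hs, hxs, hsu⟩ := Real.isTopologicalBasis_Ioo_rat.exists_subset_of_mem_open hx hu
    exact ⟨s, hs, (Real.isTopologicalBasis_Ioo_rat.isOpen hs).mem_nhds hxs, hsu⟩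
  · intro s hs
    simp only [Set.mem_iUnion, Set.mem_singleton_iff] at hs
    obtain ⟨p, q, -, rfl⟩ := hs
    exact NNReal.tendsto_coe.1 (h p q)

/-- The law of the time scale `c⁻¹` times the holding time at a site whose depth is drawn according
to the law of `X` size-biased by `X ^ a`. -/
theorem exists_sizeBiased_holdLaw {Ω : Type*} [MeasurableSpace Ω] {P : Measure Ω}
    [IsProbabilityMeasure P] {X : Ω → ℝ} (hX : Measurable X) (hX0 : ∀ ω, 0 < X ω) {a : ℝ}
    (hint : Integrable (fun ω => X ω ^ a) P) (c : ℝ) :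
    ∃ ν : ProbabilityMeasure ℝ, ∀ B : Set ℝ, MeasurableSet B → (ν : Measure ℝ).real B =
      (∫ ω, X ω ^ a * holdProb a c B (X ω) ∂P) / ∫ ω, X ω ^ a ∂P := by
  have hp : ∀ ω, 0 < X ω ^ a := fun ω => Real.rpow_pos_of_pos (hX0 ω) a
  set E := ∫ ω, X ω ^ a ∂P with hEdef
  have hE : 0 < E := by
    rw [hEdef, integral_pos_iff_support_of_nonneg (fun ω => (hp ω).le) hint]
    have : Function.support (fun ω => X ω ^ a) = Set.univ :=
      Set.eq_univ_of_forall fun ω => (hp ω).ne'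
    simp [this]
  have hw : Measurable fun ω => ENNReal.ofReal (X ω ^ a / E) :=
    ((hX.pow_const a).div_const E).ennreal_ofReal
  -- The size-biased law, under which the depth is drawn before an independent exponential variable.
  set Q : Measure Ω := P.withDensity fun ω => ENNReal.ofReal (X ω ^ a / E) with hQ
  have hQ1 : IsProbabilityMeasure Q := by
    refine ⟨?_⟩
    rw [hQ, withDensity_apply _ .univ, setLIntegral_univ,
      ← ofReal_integral_eq_lintegral_ofReal (hint.div_const E)
        (ae_of_all _ fun ω => (div_pos (hp ω) hE).le), integral_div, div_self hE.ne',
      ENNReal.ofReal_one]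
  have hG : Measurable fun p : Ω × ℝ => c⁻¹ * (X p.1 ^ (-(1 - a)))⁻¹ * p.2 := by
    have : Measurable fun p : Ω × ℝ => X p.1 := hX.comp measurable_fst
    fun_prop
  refine ⟨⟨(Q.prod (expMeasure 1)).map fun p => c⁻¹ * (X p.1 ^ (-(1 - a)))⁻¹ * p.2,
    Measure.isProbabilityMeasure_map hG.aemeasurable⟩, fun B hB => ?_⟩
  have hh : Measurable fun ω => holdProb a c B (X ω) := (measurable_holdProb a c hB).comp hX
  have hsec : ∀ ω, expMeasure 1 (Prod.mk ω ⁻¹'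
      ((fun p : Ω × ℝ => c⁻¹ * (X p.1 ^ (-(1 - a)))⁻¹ * p.2) ⁻¹' B)) =
      ENNReal.ofReal (holdProb a c B (X ω)) := fun ω => by
    rw [holdProb, ofReal_measureReal]
    rfl
  rw [ProbabilityMeasure.coe_mk, measureReal_def, Measure.map_apply hG hB,
    Measure.prod_apply (hG hB)]
  simp only [hsec]
  rw [hQ, lintegral_withDensity_eq_lintegral_mul _ hw hh.ennreal_ofReal, ← integral_div,
    integral_eq_lintegral_of_nonneg_ae (ae_of_all _ fun ω =>
      div_nonneg (mul_nonneg (hp ω).le (holdProb_nonneg _ _ _ _)) hE.le)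
      (((hX.pow_const a).mul hh).div_const E).aestronglyMeasurable]
  congr 1
  refine lintegral_congr fun ω => ?_
  rw [Pi.mul_apply, ← ENNReal.ofReal_mul (div_pos (hp ω) hE).le]
  congr 1
  ring

/-- A neighborhood of `δ_∞` contains the laws on `[0, ∞]` which charge a long interval little. -/
theorem exists_nat_forall_mem_of_mem_nhds_dirac_top {U : Set (ProbabilityMeasure ℝ≥0∞)}
    {δ : ProbabilityMeasure ℝ≥0∞} (hδ : (δ : Measure ℝ≥0∞) = Measure.dirac ∞) (hU : U ∈ 𝓝 δ) :
    ∃ K : ℕ, ∀ ν : ProbabilityMeasure ℝ≥0∞,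
      (ν : Measure ℝ≥0∞).real (Set.Iic (K : ℝ≥0∞)) < 1 / ((K : ℝ) + 1) → ν ∈ U := by
  by_contra! H
  choose ν hν hνU using H
  have hlim : Tendsto ν atTop (𝓝 δ) := by
    -- Counterexamples for every `K` would converge to `δ`, by the open-set criterion: only open
    -- sets containing `∞` matter, and those contain some `(b, ∞]`.
    refine tendsto_of_forall_isOpen_le_liminf_nat' fun G hG => ?_
    rw [hδ, Measure.dirac_apply' _ hG.measurableSet]
    by_cases hG' : ∞ ∈ G
    · obtain ⟨b, hb, hbG⟩ := ENNReal.nhds_top_basis.mem_iff.1 (hG.mem_nhds hG')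
      obtain ⟨N, hN⟩ := ENNReal.exists_nat_gt hb.ne
      have h1 : Tendsto (fun k : ℕ => ENNReal.ofReal (1 - 1 / ((k : ℝ) + 1))) atTop (𝓝 1) := by
        have := ENNReal.tendsto_ofReal
          (tendsto_one_div_add_atTop_nhds_zero_nat (𝕜 := ℝ).const_sub 1)
        simpa using this
      rw [Set.indicator_of_mem hG', Pi.one_apply, ← h1.liminf_eq]
      refine liminf_le_liminf ?_
      filter_upwards [eventually_ge_atTop N] with k hk
      have hsub : (Set.Iic (k : ℝ≥0∞))ᶜ ⊆ G := by
        rw [Set.compl_Iic]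
        exact (Set.Ioi_subset_Ioi (hN.le.trans (by exact_mod_cast hk))).trans hbG
      refine le_trans ?_ (measure_mono hsub)
      rw [← ofReal_measureReal, probReal_compl_eq_one_sub measurableSet_Iic]
      exact ENNReal.ofReal_le_ofReal (sub_le_sub_left (hν k).le 1)
    · rw [Set.indicator_of_notMem hG']
      exact zero_le
  obtain ⟨k, hk⟩ := (hlim.eventually hU).exists
  exact hνU k hk

end TrapModel

theorem proposition4
    {Ω : Type*} [MeasurableSpace Ω] (P : Measure Ω) [IsProbabilityMeasure P]
    {Y : Type*} [MeasurableSpace Y]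
    (α a r : ℝ) (hα0 : 0 < α) (hα1 : α < 1) (ha0 : 0 ≤ a) (ha1 : a < 1) (hr : 0 < r)
    -- the landscape: i.i.d. positive random variables with law in `𝒟(α)`
    (τ : ℕ → Ω → ℝ) (hτ_meas : ∀ x, Measurable (τ x)) (hτ_pos : ∀ x ω, 0 < τ x ω)
    (hτ_indep : iIndepFun τ P) (hτ_ident : ∀ x, IdentDistrib (τ x) (τ 0) P P)
    (hτ_tail : TrapModel.InDomain α (P.map (τ 0)))
    -- for each `n` and each landscape, the dynamics on `n + 1` vertices, started from `π`
    (D : ∀ (n : ℕ) (ω : Ω),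
      TrapModel.Dynamics a (fun x : Fin (n + 1) => τ x ω)
        (TrapModel.invMeas a (fun x : Fin (n + 1) => τ x ω)) Y) :
    (a < α →
      Integrable (fun ω => τ 0 ω ^ a) P ∧
      ∃ ν : ProbabilityMeasure ℝ,
        (ν : Measure ℝ) (Set.Iic 0) = 0 ∧
        (∀ u : ℝ, 0 < u → (ν : Measure ℝ).real (Set.Ioi u) =
          (∫ ω, τ 0 ω ^ a * Real.exp (-(u * (r / τ 0 ω) ^ (1 - a))) ∂P) / ∫ ω, τ 0 ω ^ a ∂P) ∧
        ∀ᵐ ω ∂P, Tendsto (fun n => (D n ω).clockLaw (r ^ (1 - a))) atTop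
          (𝓝 (TrapModel.renewalLaw ν))) ∧
    (α < a →
      TrapModel.TendstoInProb P (fun n ω => (D n ω).clockLawExt (r ^ (1 - a)))
        (TrapModel.renewalLaw ⟨Measure.dirac (∞ : ℝ≥0∞), inferInstance⟩)) := by
  open TrapModel in
  have hc : 0 < r ^ (1 - a) := Real.rpow_pos_of_pos hr _
  refine ⟨fun ha => ?_, fun ha => ?_⟩
  · have hint := hτ_tail.integrable_rpow (hτ_meas 0) (hτ_pos 0) ha0 ha
    obtain ⟨ν, hν⟩ := exists_sizeBiased_holdLaw (hτ_meas 0) (hτ_pos 0) hint (r ^ (1 - a))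
    refine ⟨hint, ν, ?_, fun u hu => ?_, ?_⟩
    · rw [← measureReal_eq_zero_iff, hν _ measurableSet_Iic]
      simp [holdProb_Iic hc (hτ_pos 0 _) le_rfl]
    · rw [hν _ measurableSet_Ioi]
      congr 1
      refine integral_congr_ae (ae_of_all _ fun ω => ?_)
      have ht := hτ_pos 0 ω
      simp only
      rw [holdProb_Ioi hc ht hu.le, Real.div_rpow hr.le ht.le, Real.rpow_neg ht.le,
        div_eq_mul_inv]
    · have key : ∀ p q : ℚ, ∀ᵐ ω ∂P, Tendsto
          (fun n => ((D n ω).incrementLaw (r ^ (1 - a)) : Measure ℝ).real (Set.Ioo (p : ℝ) q))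
          atTop (𝓝 ((ν : Measure ℝ).real (Set.Ioo (p : ℝ) q))) := by
        intro p q
        filter_upwards [ae_tendsto_sum_invMeas (hτ_meas 0) hτ_pos hτ_indep hτ_ident hint
          (measurable_holdProb a (r ^ (1 - a)) (measurableSet_Ioo (a := (p : ℝ)) (b := q)))
          (holdProb_nonneg _ _ _) (holdProb_le_one _ _ _)] with ω hω
        rw [hν _ measurableSet_Ioo]
        exact hω.congr fun n => ((D n ω).incrementLaw_real _ measurableSet_Ioo).symm
      filter_upwards [ae_all_iff.2 fun p => ae_all_iff.2 (key p)] with ω hω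
      simp only [Dynamics.clockLaw_eq_renewalLaw]
      exact (continuous_renewalLaw.tendsto ν).comp (tendsto_of_forall_Ioo_rat hω)
  · intro U hU
    -- By continuity, membership in `U` reduces to one inequality on the mass that the increment law
    -- gives to `[0, K]`.
    obtain ⟨K, hK⟩ := exists_nat_forall_mem_of_mem_nhds_dirac_top rfl
      (continuous_renewalLaw.continuousAt.preimage_mem_nhds hU)
    have hm := measurable_holdProb a (r ^ (1 - a)) (measurableSet_Iic (a := (K : ℝ)))
    set f : ℕ → Ω → ℝ := fun n ω => ∑ x : Fin (n + 1),
      invMeas a (fun x : Fin (n + 1) => τ x ω) x *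
        holdProb a (r ^ (1 - a)) (Set.Iic (K : ℝ)) (τ x ω)
    have hfm : ∀ n, Measurable (f n) := by
      intro n
      refine Finset.measurable_fun_sum _ fun x _ => Measurable.mul ?_ (hm.comp (hτ_meas x))
      exact ((hτ_meas x).pow_const a).div
        (Finset.measurable_fun_sum _ fun y _ => (hτ_meas y).pow_const a)
    have hlim : ∀ᵐ ω ∂P, Tendsto (fun n => f n ω) atTop (𝓝 0) := by
      filter_upwards [ae_tendsto_sum_rpow_atTop (hτ_meas 0) hτ_pos hτ_indep hτ_ident ha0 ha
        hτ_tail] with ω hω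
      exact tendsto_sum_invMeas_of_tendsto_atTop (fun x => hτ_pos x ω) ha0 hω
        (holdProb_nonneg _ _ _) (holdProb_le_one _ _ _)
        (tendsto_holdProb_Iic ha1 hc K.cast_nonneg)
    have hprob := tendstoInMeasure_of_tendsto_ae
      (fun n => (hfm n).aestronglyMeasurable) hlim
    rw [tendstoInMeasure_iff_dist] at hprob
    -- The exceptional event need not be measurable, as `D n ω` depends arbitrarily on `ω`;
    -- monotonicity bounds it by the measurable event `1 / (K + 1) ≤ |f n|`.
    refine tendsto_of_tendsto_of_tendsto_of_le_of_le tendsto_const_nhds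
      (hprob (1 / ((K : ℝ) + 1)) (by positivity)) (fun _ => zero_le) fun n =>
      measure_mono fun ω hω => ?_
    by_contra hlt
    refine hω ?_
    beta_reduce
    rw [(D n ω).clockLawExt_eq_renewalLaw hc fun x => hτ_pos x ω]
    refine hK _ ?_
    have hpre : ENNReal.ofReal ⁻¹' Set.Iic (K : ℝ≥0∞) = Set.Iic (K : ℝ) := by
      ext s
      simp
    have h1 : ((D n ω).incrementLawExt (r ^ (1 - a)) : Measure ℝ≥0∞).real (Set.Iic (K : ℝ≥0∞)) =
        f n ω := by
      rw [Dynamics.incrementLawExt, ProbabilityMeasure.toMeasure_map,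
        map_measureReal_apply ENNReal.measurable_ofReal measurableSet_Iic, hpre,
        (D n ω).incrementLaw_real _ measurableSet_Iic]
    rw [h1]
    exact (le_abs_self _).trans_lt (by simpa [Real.dist_eq] using hlt)
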